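/- Let $S^1=\mathbb{R}/\mathbb{Z}$ be the circle of length one, and for $t>0$ and $f\in L^1(S^1)$ let $$[e^{t\Delta}f](x)=\sum_{k\in\mathbb{Z}}e^{-4\pi^2k^2t}\,\widehat f(k)\,e^{2\pi i k x},\qquad \widehat f(k)=\int_{S^1}f(y)e^{-2\pi i k y}\,dy,$$ be the solution at time $t$ of the heat equation on $S^1$ with initial datum $f$. For every $t>0$ there is $N(t)\in\mathbb{N}$, depending only on $t$, such that for all $n\ge N(t)$ the following holds: points $x_1,\dots,x_n\in S^1$ minimize, among all choices of $n$ points of $S^1$, the worst-case sampling error $$\sup_{0\ne f\in L^1(S^1)}\frac{1}{\|f\|_{L^1}}\left|\frac1n\sum_{k=1}^n[e^{t\Delta}f](x_k)-\int_{S^1}f(x)\,dx\right|$$ if and only if they are equispaced, that is, up to relabelling, $x_k=z+\frac{k-1}{n} \pmod 1$ for $k=1,\dots,n$ and some $z\in S^1$. -/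

import Mathlib

noncomputable section

open MeasureTheory AddCircle

namespace HeatSampling

/-- The heat semigroup `e^{tΔ}`, with `Δ = d²/dx²` on the circle `S¹ = ℝ/ℤ` of length one, as a
Fourier multiplier: the character `e^{2πikx}` is an eigenfunction of `Δ` with eigenvalue
`-4π²k²`. For `t > 0` and integrable `f` the series converges absolutely (see
`summable_heatFlow`) and gives the smooth representative of `e^{tΔ}f`, so that point values make
sense. -/
def heatFlow (t : ℝ) (f : UnitAddCircle → ℂ) (x : UnitAddCircle) : ℂ :=
  ∑' k : ℤ, (Real.exp (-(4 * Real.pi ^ 2 * (k : ℝ) ^ 2 * t)) : ℂ) * fourierCoeff f k * fourier k x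

/-- The error made when `∫ f` is estimated by averaging `e^{tΔ}f` over the points `x₁, …, xₙ`.
`haarAddCircle` is the length measure of `ℝ/ℤ`, of total mass one. -/
def samplingError {n : ℕ} (t : ℝ) (x : Fin n → UnitAddCircle) (f : UnitAddCircle → ℂ) : ℝ :=
  ‖(1 / (n : ℂ)) * (∑ k, heatFlow t f (x k)) - ∫ y, f y ∂haarAddCircle‖

/-- The worst case of the sampling error, relative to the `L¹` norm, over all nonzero
`f ∈ L¹(S¹)`. The supremum is taken in `[0, ∞]`. -/
def worstCaseError {n : ℕ} (t : ℝ) (x : Fin n → UnitAddCircle) : ENNReal :=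
  ⨆ (f : Lp ℂ 1 (haarAddCircle (T := (1 : ℝ)))) (_ : f ≠ 0),
    ENNReal.ofReal (samplingError t x f / ‖f‖)

/-- The points `x₁, …, xₙ` are equispaced on the circle: up to relabelling they are
`z, z + 1/n, …, z + (n-1)/n` for some `z`. -/
def Equispaced {n : ℕ} (x : Fin n → UnitAddCircle) : Prop :=
  ∃ (z : UnitAddCircle) (σ : Equiv.Perm (Fin n)),
    ∀ k : Fin n, x (σ k) = z + (((k : ℝ) / (n : ℝ) : ℝ) : UnitAddCircle)

theorem summable_heatFlow {t : ℝ} (ht : 0 < t) (f : UnitAddCircle → ℂ) (x : UnitAddCircle) :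
    Summable fun k : ℤ =>
      (Real.exp (-(4 * Real.pi ^ 2 * (k : ℝ) ^ 2 * t)) : ℂ) * fourierCoeff f k * fourier k x := by
  have hg : Summable fun k : ℤ => Real.exp (-(4 * Real.pi ^ 2 * (k : ℝ) ^ 2 * t)) := by
    have h := (summable_jacobiTheta₂_term_iff 0 (Complex.I * ((4 * Real.pi * t : ℝ) : ℂ))).2
      (by simp; positivity)
    refine h.norm.congr fun k => ?_
    rw [norm_jacobiTheta₂_term]
    congr 1
    simp
    ring
  refine Summable.of_norm_bounded (hg.mul_right (∫ y, ‖f y‖ ∂haarAddCircle)) fun k => ?_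
  have hb : ‖fourierCoeff f k‖ ≤ ∫ y, ‖f y‖ ∂haarAddCircle := by
    refine (norm_integral_le_integral_norm _).trans (le_of_eq ?_)
    refine integral_congr_ae (Filter.Eventually.of_forall fun y => ?_)
    change ‖(fourier (-k) y : ℂ) * f y‖ = ‖f y‖
    rw [norm_mul, fourier_apply, Circle.norm_coe, one_mul]
  have h1 : ‖(Real.exp (-(4 * Real.pi ^ 2 * (k : ℝ) ^ 2 * t)) : ℂ)‖
      = Real.exp (-(4 * Real.pi ^ 2 * (k : ℝ) ^ 2 * t)) := by
    rw [Complex.norm_real, Real.norm_of_nonneg (Real.exp_pos _).le]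
  have h2 : ‖(fourier k x : ℂ)‖ = 1 := by rw [fourier_apply, Circle.norm_coe]
  rw [norm_mul, norm_mul, h1, h2, mul_one]
  exact mul_le_mul_of_nonneg_left hb (Real.exp_pos _).le

end HeatSampling

end

/-! By L¹–L^∞ duality the worst-case error is governed by the real function H(y) = (1/n) Σ_j K(x_j -
y) - 1, with K the heat kernel. For equispaced points only the frequencies divisible by n survive in
H; their coefficients are positive, so the error is the value at a node, `combMax t n - 1`, of order
e^{-4π²n²t}. It remains to show that every configuration with error at most this value is equispaced
(`equispaced_of_worstCaseError_le`).

Testing with characters shows that the power sums p_k = Σ_j e(k x_j), with e(x) = e^{2πix}, are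
small for 1 ≤ k ≤ n/2. Let ε be the largest modulus, attained at k = r. Newton's identities bound
the first half of the elementary symmetric functions of the e(x_j) by ε. Since these numbers have
modulus one, the second half mirrors the first, so ∏(X - e(x_j)) is X^n - w up to coefficients of
size ε. Hence the x_j lie within O(ε) of one coset of the n-torsion (`norm_pow_sub_pow_le`).

Now average H over a coset of the n-torsion with nonnegative weights 1 + Re(u e(-rl/n)). This leaves
only the frequencies ≡ 0 and ≡ ±r mod n and gives Re Σ_j K_0 + |Σ_j K_r| ≤ n · `combMax t n`, where
K_s is the comb of frequencies ≡ s (`re_combKernel_add_norm_le`). The comb K_0 is at its maximum on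
the coset, so Re Σ_j K_0 falls short of n · `combMax t n` only quadratically in ε and with a far
smaller Gaussian weight than e^{-4π²r²t}. The comb K_r contributes about e^{-4π²r²t} ε. For large n
this forces ε = 0.

If n = 2r, the frequencies r and -r lie in the same class and K_r may nearly cancel. Moving the base
point by a multiple of ε recovers a gain of order ε², which still beats the loss.

When ε = 0 the polynomial is X^n - w with w ≠ 0, so the points are n distinct elements of one coset.
-/

noncomputable section

open MeasureTheory AddCircle

namespace HeatSampling

/-! ### Power sums and elementary symmetric functions of unit complex numbers. -/

section PowerSums

open Finset

variable {n : ℕ}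

/-- Elementary symmetric functions of a finite family. -/
def elemSymm (z : Fin n → ℂ) (k : ℕ) : ℂ := ∑ s ∈ powersetCard k univ, ∏ i ∈ s, z i

theorem elemSymm_eq_aeval (z : Fin n → ℂ) (k : ℕ) :
    elemSymm z k = MvPolynomial.aeval z (MvPolynomial.esymm (Fin n) ℂ k) := by
  simp [elemSymm, MvPolynomial.esymm]

theorem elemSymm_zero (z : Fin n → ℂ) : elemSymm z 0 = 1 := by
  simp [elemSymm]

theorem mul_elemSymm_eq_sum (z : Fin n → ℂ) (k : ℕ) :
    (k : ℂ) * elemSymm z k = (-1) ^ (k + 1) *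
      ∑ i ∈ range k, (-1) ^ i * elemSymm z i * ∑ j, z j ^ (k - i) := by
  have h := congrArg (MvPolynomial.aeval z) (MvPolynomial.mul_esymm_eq_sum (Fin n) ℂ k)
  simp only [map_mul, map_sum, map_pow, map_neg, map_one, map_natCast, ← elemSymm_eq_aeval,
    MvPolynomial.psum, MvPolynomial.aeval_X] at h
  rw [h]
  congr 1
  refine sum_nbij' (fun a => a.1) (fun i => (i, k - i)) ?_ ?_ ?_ ?_ ?_
  · simp
  · intro i hi
    simp at hi ⊢
    omega
  · intro a ha
    simp at ha
    ext <;> simp; omega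
  · simp
  · intro a ha
    simp at ha
    have : k - a.1 = a.2 := by omega
    simp [this]

/-- Newton's identity writes k e_k as a signed sum of k products e_i p_{k-i}. Inductively |e_i| ≤ 1,
so each product is at most ε, and the factor k cancels: there is no loss in the constant. -/
theorem norm_elemSymm_le (z : Fin n → ℂ) {ε : ℝ} (hε1 : ε ≤ 1) {K : ℕ}
    (hp : ∀ k, 1 ≤ k → k ≤ K → ‖∑ j, z j ^ k‖ ≤ ε) :
    ∀ k, 1 ≤ k → k ≤ K → ‖elemSymm z k‖ ≤ ε := by
  intro k
  induction k using Nat.strong_induction_on with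
  | _ k ih =>
    intro hk hkK
    have hone : ∀ i ∈ range k, ‖elemSymm z i‖ ≤ 1 := by
      intro i hi
      rcases Nat.eq_zero_or_pos i with rfl | hi0
      · simp [elemSymm_zero]
      · have := mem_range.1 hi
        exact (ih i this hi0 (by omega)).trans hε1
    have hmul : (k : ℝ) * ‖elemSymm z k‖ ≤ k * ε := by
      have h := congrArg norm (mul_elemSymm_eq_sum z k)
      rw [norm_mul, norm_mul, norm_pow, norm_neg, norm_one, one_pow, one_mul,
        Complex.norm_natCast] at h
      rw [h]
      refine (norm_sum_le _ _).trans ?_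
      calc ∑ i ∈ range k, ‖(-1) ^ i * elemSymm z i * ∑ j, z j ^ (k - i)‖
          ≤ ∑ i ∈ range k, ε := by
            refine sum_le_sum fun i hi => ?_
            have hik := mem_range.1 hi
            rw [norm_mul, norm_mul, norm_pow, norm_neg, norm_one, one_pow, one_mul]
            calc _ ≤ 1 * ε := mul_le_mul (hone i hi) (hp _ (by omega) (by omega))
                  (norm_nonneg _) zero_le_one
              _ = ε := one_mul _
        _ = k * ε := by simp
    exact le_of_mul_le_mul_left hmul (by exact_mod_cast hk)

/-- Complementing index sets and using 1/z = conj z gives e_{n-k} = e_n · conj e_k. This is why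
control of half of the power sums suffices. -/
theorem norm_elemSymm_sub (z : Fin n → ℂ) (hz : ∀ j, ‖z j‖ = 1) {k : ℕ} (hk : k ≤ n) :
    ‖elemSymm z (n - k)‖ = ‖elemSymm z k‖ := by
  have h : elemSymm z (n - k) = (∏ j, z j) * (starRingEnd ℂ) (elemSymm z k) := by
    rw [elemSymm, elemSymm, map_sum, mul_sum]
    refine sum_nbij' (fun s => sᶜ) (fun s => sᶜ) ?_ ?_ ?_ ?_ ?_
    · intro s hs
      simp [card_compl] at hs ⊢
      omega
    · intro s hs
      simp [card_compl] at hs ⊢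
      omega
    · simp
    · simp
    · intro s _
      rw [← prod_mul_prod_compl s z, mul_assoc, map_prod, ← prod_mul_distrib]
      have : ∀ i, z i * (starRingEnd ℂ) (z i) = 1 := by
        intro i
        rw [Complex.mul_conj, Complex.normSq_eq_norm_sq, hz]
        simp
      simp [this]
  rw [h, norm_mul, norm_prod]
  simp [hz]

theorem prod_sub_eq_sum_elemSymm (z : Fin n → ℂ) (X : ℂ) :
    ∏ j, (X - z j) = ∑ k ∈ range (n + 1), (-1) ^ k * elemSymm z k * X ^ (n - k) := by
  have h := congrArg (Polynomial.eval X)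
    (Multiset.prod_X_sub_X_eq_sum_esymm ((univ : Finset (Fin n)).val.map z))
  simp only [Multiset.map_map, Multiset.card_map, card_val, card_univ, Fintype.card_fin,
    Polynomial.eval_finsetSum, Polynomial.eval_mul, Polynomial.eval_pow, Polynomial.eval_neg,
    Polynomial.eval_one, Polynomial.eval_C, Polynomial.eval_X,
    ← MvPolynomial.aeval_esymm_eq_multiset_esymm (Fin n) ℂ, ← elemSymm_eq_aeval] at h
  rw [Polynomial.eval_multiset_prod, Multiset.map_map] at h
  simp only [Function.comp_def, Polynomial.eval_sub, Polynomial.eval_X, Polynomial.eval_C] at h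
  simpa [Finset.prod, mul_assoc] using h

/-- If the first half of the power sums of `n` unit complex numbers is small, then their
monic polynomial is close to `X ^ n - w`. -/
theorem exists_norm_prod_sub_le (hn : 1 ≤ n) (z : Fin n → ℂ) (hz : ∀ j, ‖z j‖ = 1) {ε : ℝ}
    (hε1 : ε ≤ 1) (hp : ∀ k, 1 ≤ k → 2 * k ≤ n → ‖∑ j, z j ^ k‖ ≤ ε) :
    ∃ w : ℂ, ∀ X : ℂ, ‖∏ j, (X - z j) - (X ^ n - w)‖ ≤
      ε * ∑ k ∈ range (n - 1), ‖X‖ ^ (n - (k + 1)) := by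
  have he : ∀ k, 1 ≤ k → k < n → ‖elemSymm z k‖ ≤ ε := by
    have h0 := norm_elemSymm_le z hε1 (K := n / 2) (fun k h1 h2 => hp k h1 (by omega))
    intro k hk hkn
    rcases le_or_gt k (n / 2) with h | h
    · exact h0 k hk h
    · rw [← norm_elemSymm_sub z hz hkn.le]
      exact h0 _ (by omega) (by omega)
  refine ⟨-((-1) ^ n * elemSymm z n), fun X => ?_⟩
  obtain ⟨m, rfl⟩ : ∃ m, n = m + 1 := ⟨n - 1, by omega⟩
  have : ∏ j, (X - z j) - (X ^ (m + 1) - -((-1) ^ (m + 1) * elemSymm z (m + 1)))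
      = ∑ k ∈ range m, (-1) ^ (k + 1) * elemSymm z (k + 1) * X ^ (m + 1 - (k + 1)) := by
    rw [prod_sub_eq_sum_elemSymm, sum_range_succ, sum_range_succ', elemSymm_zero]
    simp
  rw [this, Nat.add_sub_cancel, mul_sum]
  refine (norm_sum_le _ _).trans (sum_le_sum fun k hk => ?_)
  have hk := mem_range.1 hk
  rw [norm_mul, norm_mul, norm_pow, norm_pow, norm_neg, norm_one, one_pow, one_mul]
  exact mul_le_mul_of_nonneg_right (he _ (by omega) (by omega)) (by positivity)

/-- Evaluating the nearly binomial polynomial at its own root z_i makes the product vanish, so z_i^n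
is within nε of the common constant w. -/
theorem norm_pow_sub_pow_le (hn : 1 ≤ n) (z : Fin n → ℂ) (hz : ∀ j, ‖z j‖ = 1) {ε : ℝ}
    (hε : 0 ≤ ε) (hε1 : ε ≤ 1) (hp : ∀ k, 1 ≤ k → 2 * k ≤ n → ‖∑ j, z j ^ k‖ ≤ ε) (i j : Fin n) :
    ‖z i ^ n - z j ^ n‖ ≤ 2 * n * ε := by
  obtain ⟨w, hw⟩ := exists_norm_prod_sub_le hn z hz hε1 hp
  have key : ∀ i, ‖z i ^ n - w‖ ≤ n * ε := by
    intro i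
    have h := hw (z i)
    rw [prod_eq_zero (mem_univ i) (sub_self _), zero_sub, norm_neg] at h
    refine h.trans ?_
    rw [hz]
    simp only [one_pow, sum_const, card_range, nsmul_eq_mul, mul_one]
    rw [mul_comm]
    gcongr
    omega
  calc ‖z i ^ n - z j ^ n‖ = ‖(z i ^ n - w) - (z j ^ n - w)‖ := by congr 1; ring
    _ ≤ ‖z i ^ n - w‖ + ‖z j ^ n - w‖ := norm_sub_le _ _
    _ ≤ n * ε + n * ε := add_le_add (key i) (key j)
    _ = _ := by ring

theorem injective_of_powerSum_eq_zero (hn : 1 ≤ n) (z : Fin n → ℂ) (hz : ∀ j, ‖z j‖ = 1)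
    (hp : ∀ k, 1 ≤ k → 2 * k ≤ n → ∑ j, z j ^ k = 0) : Function.Injective z := by
  obtain ⟨w, hw⟩ := exists_norm_prod_sub_le hn z hz zero_le_one
    (fun k h1 h2 => by rw [hp k h1 h2, norm_zero])
  have hX : ∀ X : ℂ, ∏ j, (X - z j) = X ^ n - w := by
    intro X
    have := hw X
    rw [zero_mul, norm_le_zero_iff, sub_eq_zero] at this
    exact this
  have hpoly : ∏ j, (Polynomial.X - Polynomial.C (z j)) = Polynomial.X ^ n - Polynomial.C w := by
    refine Polynomial.funext fun X => ?_
    simpa [Polynomial.eval_prod] using hX X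
  have hw0 : w ≠ 0 := by
    have h := hX (z ⟨0, hn⟩)
    rw [prod_eq_zero (mem_univ _) (sub_self _)] at h
    intro h0
    rw [h0, sub_zero] at h
    have := congrArg norm h
    rw [norm_pow, hz] at this
    simp at this
  have hsep : (∏ j, (Polynomial.X - Polynomial.C (z j))).Separable := by
    rw [hpoly]
    exact Polynomial.separable_X_pow_sub_C w (by exact_mod_cast (by omega : n ≠ 0)) hw0
  exact Polynomial.separable_prod_X_sub_C_iff.1 hsep

end PowerSums

/-! ### Gaussian tails, the heat kernel, and duality for the worst-case error. -/

section Kernel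

/-- The Fourier multiplier of the heat semigroup. -/
def gaussWeight (t : ℝ) (k : ℤ) : ℝ := Real.exp (-(4 * Real.pi ^ 2 * (k : ℝ) ^ 2 * t))

theorem gaussWeight_pos (t : ℝ) (k : ℤ) : 0 < gaussWeight t k := Real.exp_pos _

theorem gaussWeight_zero (t : ℝ) : gaussWeight t 0 = 1 := by simp [gaussWeight]

theorem gaussWeight_neg (t : ℝ) (k : ℤ) : gaussWeight t (-k) = gaussWeight t k := by
  simp [gaussWeight]

theorem summable_pow_mul_gaussWeight {t : ℝ} (ht : 0 < t) (i : ℕ) :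
    Summable fun k : ℤ => |(k : ℝ)| ^ i * gaussWeight t k := by
  have h := summable_pow_mul_jacobiTheta₂_term_bound 0 (T := 4 * Real.pi * t) (by positivity) i
  refine h.congr fun k => ?_
  rw [gaussWeight]
  push_cast
  congr 2
  ring

theorem summable_gaussWeight {t : ℝ} (ht : 0 < t) : Summable (gaussWeight t) := by
  simpa using summable_pow_mul_gaussWeight ht 0

theorem summable_sq_mul_gaussWeight {t : ℝ} (ht : 0 < t) :
    Summable fun k : ℤ => (k : ℝ) ^ 2 * gaussWeight t k := by
  simpa using summable_pow_mul_gaussWeight ht 2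

/-- A constant controlling all tails of Gaussian sums. -/
def tailConst (t : ℝ) : ℝ :=
  Real.exp (4 * Real.pi ^ 2 * t) * ∑' m : ℤ, (m : ℝ) ^ 2 * gaussWeight t m

theorem tailConst_nonneg (t : ℝ) : 0 ≤ tailConst t :=
  mul_nonneg (Real.exp_pos _).le
    (tsum_nonneg fun m => mul_nonneg (sq_nonneg _) (gaussWeight_pos t m).le)

/-- The common ratio `e^{-4π²t}`. -/
def heatRatio (t : ℝ) : ℝ := Real.exp (-(4 * Real.pi ^ 2 * t))

theorem heatRatio_pos (t : ℝ) : 0 < heatRatio t := Real.exp_pos _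

/-- The hypothesis compares exponents. The term m² keeps a summable weight in m, and the slack 1
pays for m² at m = ±1, so the nearest competing frequency need only beat r² by n. -/
theorem gaussWeight_le {t : ℝ} (ht : 0 < t) {k r m : ℤ} {n : ℕ}
    (h : r ^ 2 + n + m ^ 2 ≤ k ^ 2 + 1) :
    gaussWeight t k ≤
      gaussWeight t r * heatRatio t ^ n * (Real.exp (4 * Real.pi ^ 2 * t) * gaussWeight t m) := by
  rw [gaussWeight, gaussWeight, gaussWeight, heatRatio, ← Real.exp_nat_mul, ← Real.exp_add,
    ← Real.exp_add, ← Real.exp_add, Real.exp_le_exp]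
  have h' : (r : ℝ) ^ 2 + n + (m : ℝ) ^ 2 ≤ (k : ℝ) ^ 2 + 1 := by exact_mod_cast h
  have := mul_le_mul_of_nonneg_left h' (by positivity : 0 ≤ 4 * Real.pi ^ 2 * t)
  nlinarith

theorem summable_and_tsum_tail_le {t : ℝ} (ht : 0 < t) {B : ℝ} {b : ℤ → ℝ} {g : ℤ → ℤ} {r : ℤ}
    {n : ℕ} (hb : ∀ m, 0 ≤ b m) (hbB : ∀ m, b m ≤ B * (m : ℝ) ^ 2)
    (hg : ∀ m, b m = 0 ∨ r ^ 2 + n + m ^ 2 ≤ g m ^ 2 + 1) :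
    (Summable fun m => b m * gaussWeight t (g m)) ∧
      ∑' m, b m * gaussWeight t (g m) ≤
        B * tailConst t * (gaussWeight t r * heatRatio t ^ n) := by
  have hle : ∀ m, b m * gaussWeight t (g m) ≤
      (B * (gaussWeight t r * heatRatio t ^ n) * Real.exp (4 * Real.pi ^ 2 * t)) *
        ((m : ℝ) ^ 2 * gaussWeight t m) := by
    intro m
    rcases hg m with h | h
    · rw [h, zero_mul]
      have hB : 0 ≤ B * (m : ℝ) ^ 2 := (hb m).trans (hbB m)
      have := (gaussWeight_pos t m).le
      have := (gaussWeight_pos t r).le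
      have := (heatRatio_pos t).le
      have : 0 ≤ (B * (m : ℝ) ^ 2) * ((gaussWeight t r * heatRatio t ^ n) *
        Real.exp (4 * Real.pi ^ 2 * t) * gaussWeight t m) := by positivity
      linarith
    · refine (mul_le_mul (hbB m) (gaussWeight_le ht h) (gaussWeight_pos t _).le
        ((hb m).trans (hbB m))).trans (le_of_eq ?_)
      ring
  have hs := (summable_sq_mul_gaussWeight ht).mul_left
    (B * (gaussWeight t r * heatRatio t ^ n) * Real.exp (4 * Real.pi ^ 2 * t))
  have hs' : Summable fun m => b m * gaussWeight t (g m) :=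
    Summable.of_nonneg_of_le (fun m => mul_nonneg (hb m) (gaussWeight_pos t _).le) hle hs
  refine ⟨hs', (hs'.tsum_le_tsum hle hs).trans (le_of_eq ?_)⟩
  rw [tsum_mul_left, tailConst]
  ring

theorem norm_fourier_apply (k : ℤ) (x : UnitAddCircle) : ‖(fourier k x : ℂ)‖ = 1 := by
  rw [fourier_apply, Circle.norm_coe]

theorem fourier_add_apply (k : ℤ) (x y : UnitAddCircle) :
    (fourier k (x + y) : ℂ) = fourier k x * fourier k y := by
  simp [fourier_apply, smul_add, toCircle_add]

/-- The heat kernel of the circle. -/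
def heatKernel (t : ℝ) (y : UnitAddCircle) : ℂ := ∑' k : ℤ, (gaussWeight t k : ℂ) * fourier k y

theorem norm_gaussWeight_mul_fourier (t : ℝ) (k : ℤ) (y : UnitAddCircle) :
    ‖(gaussWeight t k : ℂ) * fourier k y‖ = gaussWeight t k := by
  rw [norm_mul, norm_fourier_apply, mul_one, Complex.norm_real,
    Real.norm_of_nonneg (gaussWeight_pos t k).le]

theorem summable_heatKernel {t : ℝ} (ht : 0 < t) (y : UnitAddCircle) :
    Summable fun k : ℤ => (gaussWeight t k : ℂ) * fourier k y :=
  Summable.of_norm_bounded (summable_gaussWeight ht)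
    fun k => (norm_gaussWeight_mul_fourier t k y).le

theorem continuous_heatKernel {t : ℝ} (ht : 0 < t) : Continuous (heatKernel t) :=
  continuous_tsum (fun k => by fun_prop) (summable_gaussWeight ht)
    fun k y => (norm_gaussWeight_mul_fourier t k y).le

theorem conj_heatKernel (t : ℝ) (y : UnitAddCircle) :
    (starRingEnd ℂ) (heatKernel t y) = heatKernel t y := by
  rw [heatKernel, Complex.conj_tsum, ← (Equiv.neg ℤ).tsum_eq]
  refine tsum_congr fun k => ?_
  rw [Equiv.neg_apply, gaussWeight_neg, map_mul, Complex.conj_ofReal, fourier_neg,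
    Complex.conj_conj]

theorem heatFlow_eq_integral {t : ℝ} (ht : 0 < t) {f : UnitAddCircle → ℂ}
    (hf : Integrable f haarAddCircle) (x : UnitAddCircle) :
    heatFlow t f x = ∫ y, f y * heatKernel t (x - y) ∂haarAddCircle := by
  have hnorm : ∀ (k : ℤ) (y : UnitAddCircle),
      ‖f y * ((gaussWeight t k : ℂ) * fourier k (x - y))‖ = ‖f y‖ * gaussWeight t k := by
    intro k y
    rw [norm_mul, norm_gaussWeight_mul_fourier]
  have h := hasSum_integral_of_summable_integral_norm (μ := haarAddCircle)
    (F := fun (k : ℤ) (y : UnitAddCircle) => f y * ((gaussWeight t k : ℂ) * fourier k (x - y)))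
    (fun k => by
      refine hf.mul_bdd (c := gaussWeight t k) ?_
        (Filter.Eventually.of_forall fun y => (norm_gaussWeight_mul_fourier t k _).le)
      exact (by fun_prop : Continuous fun y : UnitAddCircle =>
        (gaussWeight t k : ℂ) * fourier k (x - y)).aestronglyMeasurable)
    (by
      simp only [hnorm, integral_mul_const]
      exact (summable_gaussWeight ht).mul_left _)
  simp only [tsum_mul_left] at h
  rw [show (fun y => f y * heatKernel t (x - y)) =
    fun y => f y * ∑' k : ℤ, (gaussWeight t k : ℂ) * fourier k (x - y) from rfl, ← h.tsum_eq,
    heatFlow]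
  refine tsum_congr fun k => ?_
  rw [fourierCoeff, ← gaussWeight, mul_assoc, ← integral_mul_const, ← integral_const_mul]
  refine integral_congr_ae (Filter.Eventually.of_forall fun y => ?_)
  simp only [sub_eq_add_neg, fourier_add_apply, smul_eq_mul]
  have : (fourier k (-y) : ℂ) = fourier (-k) y := by
    simp [fourier_apply]
  rw [this]
  ring

/-- The density of the smoothed empirical measure, minus the uniform density. -/
def discrepancyKernel {n : ℕ} (t : ℝ) (x : Fin n → UnitAddCircle) (y : UnitAddCircle) : ℂ :=
  (1 / (n : ℂ)) * (∑ j, heatKernel t (x j - y)) - 1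

variable {n : ℕ} {t : ℝ} (x : Fin n → UnitAddCircle)

theorem continuous_discrepancyKernel (ht : 0 < t) : Continuous (discrepancyKernel t x) := by
  have := continuous_heatKernel ht
  unfold discrepancyKernel
  fun_prop

theorem integrable_mul_of_continuous {f g : UnitAddCircle → ℂ} (hf : Integrable f haarAddCircle)
    (hg : Continuous g) : Integrable (fun y => f y * g y) haarAddCircle := by
  obtain ⟨C, hC⟩ := isCompact_univ.exists_bound_of_continuousOn hg.continuousOn
  exact hf.mul_bdd hg.aestronglyMeasurable
    (Filter.Eventually.of_forall fun y => hC y (Set.mem_univ y))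

theorem samplingError_eq (ht : 0 < t) {f : UnitAddCircle → ℂ} (hf : Integrable f haarAddCircle) :
    samplingError t x f = ‖∫ y, f y * discrepancyKernel t x y ∂haarAddCircle‖ := by
  have hK := continuous_heatKernel ht
  have hint : ∀ j, Integrable (fun y => f y * heatKernel t (x j - y)) haarAddCircle :=
    fun j => integrable_mul_of_continuous hf (by fun_prop)
  have h : ∀ y, f y * discrepancyKernel t x y =
      (1 / (n : ℂ)) * (∑ j, f y * heatKernel t (x j - y)) - f y := by
    intro y
    rw [discrepancyKernel, ← Finset.mul_sum]
    ring
  simp only [h]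
  rw [integral_sub ((integrable_finsetSum _ fun j _ => hint j).const_mul _) hf,
    integral_const_mul, integral_finsetSum _ fun j _ => hint j, samplingError]
  simp only [heatFlow_eq_integral ht hf]

theorem worstCaseError_le (ht : 0 < t) {C : ℝ} (hC : ∀ y, ‖discrepancyKernel t x y‖ ≤ C) :
    worstCaseError t x ≤ ENNReal.ofReal C := by
  refine iSup₂_le fun f hf => ENNReal.ofReal_le_ofReal ?_
  rw [div_le_iff₀ (norm_pos_iff.2 hf), samplingError_eq x ht (L1.integrable_coeFn f),
    L1.norm_eq_integral_norm, ← integral_const_mul]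
  refine (norm_integral_le_integral_norm _).trans
    (integral_mono_of_nonneg (Filter.Eventually.of_forall fun y => norm_nonneg _)
      ((L1.integrable_coeFn f).norm.const_mul C) (Filter.Eventually.of_forall fun y => ?_))
  simp only [norm_mul]
  rw [mul_comm]
  exact mul_le_mul_of_nonneg_right (hC y) (norm_nonneg _)

theorem heatFlow_congr_ae {f g : UnitAddCircle → ℂ} (h : f =ᵐ[haarAddCircle] g) :
    heatFlow t f = heatFlow t g := by
  funext y
  simp only [heatFlow, fourierCoeff_congr_ae h]

theorem samplingError_congr_ae {f g : UnitAddCircle → ℂ} (h : f =ᵐ[haarAddCircle] g) :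
    samplingError t x f = samplingError t x g := by
  simp only [samplingError, heatFlow_congr_ae h, integral_congr_ae h]

theorem samplingError_le_of_worstCaseError_le {C : ℝ} (hC0 : 0 ≤ C)
    (hC : worstCaseError t x ≤ ENNReal.ofReal C) {f : UnitAddCircle → ℂ}
    (hf : Integrable f haarAddCircle) (hf0 : ¬ f =ᵐ[haarAddCircle] 0) :
    samplingError t x f ≤ C * ∫ y, ‖f y‖ ∂haarAddCircle := by
  have hne : hf.toL1 f ≠ 0 := fun h =>
    hf0 (hf.coeFn_toL1.symm.trans (by rw [h]; exact Lp.coeFn_zero _ _ _))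
  have h := (le_iSup₂ (f := fun (f : Lp ℂ 1 (haarAddCircle (T := (1 : ℝ)))) (_ : f ≠ 0) =>
    ENNReal.ofReal (samplingError t x f / ‖f‖)) (hf.toL1 f) hne).trans hC
  rw [ENNReal.ofReal_le_ofReal_iff hC0, div_le_iff₀ (norm_pos_iff.2 hne),
    samplingError_congr_ae x hf.coeFn_toL1, L1.norm_eq_integral_norm] at h
  refine h.trans (le_of_eq ?_)
  congr 1
  exact integral_congr_ae (hf.coeFn_toL1.mono fun y hy => by simp only [hy])

/-- The test function is the indicator of the open set where the bound fails; a nonempty open set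
has positive Haar measure. The one-sided bound is all that the averaging argument uses. -/
theorem re_discrepancyKernel_le (ht : 0 < t) {C : ℝ} (hC0 : 0 ≤ C)
    (hC : worstCaseError t x ≤ ENNReal.ofReal C) (y : UnitAddCircle) :
    (discrepancyKernel t x y).re ≤ C := by
  by_contra! hlt
  set H := discrepancyKernel t x with hH
  have hcont : Continuous H := continuous_discrepancyKernel x ht
  set S : Set UnitAddCircle := {u | C < (H u).re} with hS
  have hSo : IsOpen S := isOpen_lt continuous_const (Complex.continuous_re.comp hcont)
  have hSpos : 0 < haarAddCircle S := hSo.measure_pos _ ⟨y, hlt⟩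
  have hreal : 0 < haarAddCircle.real S :=
    ENNReal.toReal_pos hSpos.ne' (measure_ne_top _ _)
  set f : UnitAddCircle → ℂ := S.indicator fun _ => 1 with hf
  have hfi : Integrable f haarAddCircle := (integrable_const 1).indicator hSo.measurableSet
  have hnorm : ∫ u, ‖f u‖ ∂haarAddCircle = haarAddCircle.real S := by
    have : (fun u => ‖f u‖) = S.indicator fun _ => (1 : ℝ) := by
      funext u
      by_cases hu : u ∈ S <;> simp [hf, hu]
    rw [this, integral_indicator hSo.measurableSet]
    simp
  have hf0 : ¬ f =ᵐ[haarAddCircle] 0 := by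
    intro h
    have : ∫ u, ‖f u‖ ∂haarAddCircle = 0 := by
      rw [integral_congr_ae (h.mono fun u hu => by rw [hu]; rfl : _ =ᵐ[_] fun _ => ‖(0 : ℂ)‖)]
      simp
    linarith
  have h := samplingError_le_of_worstCaseError_le x hC0 hC hfi hf0
  rw [samplingError_eq x ht hfi, hnorm] at h
  have hint := integrable_mul_of_continuous hfi hcont
  have hre : (∫ u, f u * H u ∂haarAddCircle).re = ∫ u in S, (H u).re ∂haarAddCircle := by
    rw [← integral_indicator hSo.measurableSet]
    have := integral_re (𝕜 := ℂ) hint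
    simp only [RCLike.re_eq_complex_re] at this
    rw [← this]
    congr 1
    funext u
    by_cases hu : u ∈ S <;> simp [hf, hu]
  have hHi : Integrable (fun u => (H u).re) (haarAddCircle.restrict S) :=
    ((Complex.continuous_re.comp hcont).integrable_of_hasCompactSupport
      (HasCompactSupport.of_compactSpace _)).restrict
  have hgt : 0 < ∫ u in S, ((H u).re - C) ∂haarAddCircle := by
    rw [setIntegral_pos_iff_support_of_nonneg_ae]
    · refine hSpos.trans_le (measure_mono fun u hu => ⟨?_, hu⟩)
      exact (sub_pos.2 hu).ne'
    · exact (ae_restrict_mem hSo.measurableSet).mono fun u hu => (sub_pos.2 hu).le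
    · exact hHi.sub (integrable_const C)
  rw [integral_sub hHi (integrable_const C), ← hre] at hgt
  simp only [integral_const, measureReal_restrict_apply MeasurableSet.univ, Set.univ_inter,
    smul_eq_mul] at hgt
  have := Complex.re_le_norm (∫ u, f u * H u ∂haarAddCircle)
  linarith

/-- The test function is the character itself: an eigenfunction with mean zero and L¹ norm one. -/
theorem gaussWeight_mul_norm_sum_fourier_le {C : ℝ} (hC0 : 0 ≤ C)
    (hC : worstCaseError t x ≤ ENNReal.ofReal C) {k : ℤ} (hk : k ≠ 0) :
    gaussWeight t k * ‖∑ j, (fourier k (x j) : ℂ)‖ ≤ n * C := by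
  rcases Nat.eq_zero_or_pos n with rfl | hn
  · simp
  have hflow : ∀ u, heatFlow t (fourier k : C(UnitAddCircle, ℂ)) u =
      (gaussWeight t k : ℂ) * fourier k u := by
    intro u
    rw [heatFlow, fourierCoeff_fourier, tsum_eq_single k]
    · simp [gaussWeight]
    · intro m hm
      simp [hm]
  have hint : ∫ u, (fourier k u : ℂ) ∂(haarAddCircle (T := 1)) = 0 := by
    have h := congrFun (fourierCoeff_fourier (T := 1) k) 0
    rw [Pi.single_eq_of_ne hk.symm, fourierCoeff] at h
    simpa using h
  have hi : Integrable (fourier k : C(UnitAddCircle, ℂ)) haarAddCircle :=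
    (map_continuous (fourier k)).integrable_of_hasCompactSupport
      (HasCompactSupport.of_compactSpace _)
  have hone : ∫ u, ‖(fourier k u : ℂ)‖ ∂(haarAddCircle (T := 1)) = 1 := by
    simp only [norm_fourier_apply]
    simp
  have h0 : ¬ (fourier k : C(UnitAddCircle, ℂ)) =ᵐ[haarAddCircle] 0 := by
    intro h
    rw [integral_congr_ae (h.mono fun u hu => by rw [hu]; rfl : _ =ᵐ[_] fun _ => ‖(0 : ℂ)‖)]
      at hone
    simp at hone
  have h := samplingError_le_of_worstCaseError_le x hC0 hC hi h0
  rw [hone, mul_one, samplingError, hint, sub_zero] at h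
  simp only [hflow, ← Finset.mul_sum] at h
  rw [norm_mul, norm_mul, Complex.norm_real, Real.norm_of_nonneg (gaussWeight_pos t k).le,
    norm_div, norm_one, Complex.norm_natCast, one_div,
    inv_mul_le_iff₀ (by exact_mod_cast hn)] at h
  exact h

end Kernel

/-! ### Combs of frequencies in one residue class modulo n. -/

section Comb

theorem fourier_nsmul_apply (k : ℤ) (l : ℕ) (x : UnitAddCircle) :
    (fourier k (l • x) : ℂ) = (fourier k x : ℂ) ^ l := by
  rw [fourier_apply, fourier_apply, smul_comm, toCircle_nsmul, Circle.coe_pow]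

theorem fourier_mul_apply (k m : ℤ) (x : UnitAddCircle) :
    (fourier (k * m) x : ℂ) = (fourier k x : ℂ) ^ m := by
  rw [fourier_apply, fourier_apply, mul_comm, mul_smul, toCircle_zsmul, Circle.coe_zpow]

theorem fourier_sub_mul_apply (k : ℤ) (x y : UnitAddCircle) :
    (fourier k (x - y) : ℂ) * fourier k y = fourier k x := by
  rw [← fourier_add_apply, sub_add_cancel]

variable {n : ℕ}

theorem natCast_div_eq_nsmul (l : ℕ) :
    (((l : ℝ) / (n : ℝ) : ℝ) : UnitAddCircle) = l • ((1 / (n : ℝ) : ℝ) : UnitAddCircle) := by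
  rw [← AddCircle.coe_nsmul, nsmul_eq_mul, mul_one_div]

theorem fourier_one_div_eq_one_iff (hn : 1 ≤ n) (k : ℤ) :
    (fourier k ((1 / (n : ℝ) : ℝ) : UnitAddCircle) : ℂ) = 1 ↔ (n : ℤ) ∣ k := by
  have hn0 : (n : ℂ) ≠ 0 := by exact_mod_cast (by omega : n ≠ 0)
  rw [fourier_coe_apply, Complex.exp_eq_one_iff]
  refine exists_congr fun m => ?_
  push_cast
  constructor
  · intro h
    have : (k : ℂ) = n * m := by
      field_simp at h
      exact h
    exact_mod_cast this
  · rintro rfl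
    push_cast
    field_simp

theorem sum_fourier_div (hn : 1 ≤ n) (k : ℤ) :
    ∑ l ∈ Finset.range n, (fourier k (((l : ℝ) / (n : ℝ) : ℝ) : UnitAddCircle) : ℂ) =
      if (n : ℤ) ∣ k then (n : ℂ) else 0 := by
  simp only [natCast_div_eq_nsmul, fourier_nsmul_apply]
  split_ifs with h
  · rw [(fourier_one_div_eq_one_iff hn k).2 h]
    simp
  · have h1 : (fourier k ((1 / (n : ℝ) : ℝ) : UnitAddCircle) : ℂ) ≠ 1 :=
      fun h' => h ((fourier_one_div_eq_one_iff hn k).1 h')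
    rw [geom_sum_eq h1, ← fourier_nsmul_apply, ← natCast_div_eq_nsmul,
      div_self (by exact_mod_cast (by omega : n ≠ 0) : (n : ℝ) ≠ 0)]
    have : ((1 : ℝ) : UnitAddCircle) = 0 := AddCircle.coe_period 1
    rw [this]
    simp

/-- The part of the heat kernel with frequencies congruent to `r` modulo `n`. -/
def combKernel (t : ℝ) (n : ℕ) (r : ℤ) (y : UnitAddCircle) : ℂ :=
  ∑' m : ℤ, (gaussWeight t (r + n * m) : ℂ) * fourier (r + n * m) y

variable {t : ℝ}

theorem injective_add_mul (hn : 1 ≤ n) (r : ℤ) :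
    Function.Injective fun m : ℤ => r + n * m := by
  intro a b h
  have h' : (n : ℤ) * a = n * b := by simpa using h
  exact mul_left_cancel₀ (by exact_mod_cast (by omega : n ≠ 0)) h'

theorem summable_gaussWeight_comb (ht : 0 < t) (hn : 1 ≤ n) (r : ℤ) :
    Summable fun m : ℤ => gaussWeight t (r + n * m) :=
  (summable_gaussWeight ht).comp_injective (injective_add_mul hn r)

theorem summable_combKernel (ht : 0 < t) (hn : 1 ≤ n) (r : ℤ) (y : UnitAddCircle) :
    Summable fun m : ℤ => (gaussWeight t (r + n * m) : ℂ) * fourier (r + n * m) y :=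
  (summable_heatKernel ht y).comp_injective (injective_add_mul hn r)

/-- Roots-of-unity filter: orthogonality of characters on the n-torsion retains the frequencies ≡ r
mod n. -/
theorem sum_fourier_mul_heatKernel (ht : 0 < t) (hn : 1 ≤ n) (r : ℤ) (y : UnitAddCircle) :
    ∑ l ∈ Finset.range n, (fourier (-r) (((l : ℝ) / (n : ℝ) : ℝ) : UnitAddCircle) : ℂ) *
      heatKernel t (y + (((l : ℝ) / (n : ℝ) : ℝ) : UnitAddCircle)) = n * combKernel t n r y := by
  simp only [heatKernel, ← tsum_mul_left]
  rw [← Summable.tsum_finsetSum fun l _ => (summable_heatKernel ht _).mul_left _, combKernel,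
    ← tsum_mul_left]
  have hterm : ∀ k : ℤ, ∑ l ∈ Finset.range n,
      (fourier (-r) (((l : ℝ) / (n : ℝ) : ℝ) : UnitAddCircle) : ℂ) *
        ((gaussWeight t k : ℂ) * fourier k (y + (((l : ℝ) / (n : ℝ) : ℝ) : UnitAddCircle))) =
      (gaussWeight t k : ℂ) * fourier k y * if (n : ℤ) ∣ k - r then (n : ℂ) else 0 := by
    intro k
    rw [← sum_fourier_div hn, Finset.mul_sum]
    refine Finset.sum_congr rfl fun l _ => ?_
    rw [fourier_add_apply, sub_eq_add_neg, fourier_add]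
    ring
  rw [tsum_congr hterm, ← (injective_add_mul hn r).tsum_eq]
  · refine tsum_congr fun m => ?_
    simp
    ring
  · intro k hk
    have : (n : ℤ) ∣ k - r := by
      by_contra h
      simp [h] at hk
    obtain ⟨m, hm⟩ := this
    exact ⟨m, by simp only; omega⟩

/-- The largest value of the heat kernel averaged over equispaced points. -/
def combMax (t : ℝ) (n : ℕ) : ℝ := ∑' m : ℤ, gaussWeight t (n * m)

/-- Averaging over `n` shifted copies with nonnegative weights `1 + Re (u e^{-2πirl/n})`. -/
theorem re_combKernel_add_norm_le (ht : 0 < t) (hn : 1 ≤ n) {C : ℝ} (x : Fin n → UnitAddCircle)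
    (hx : ∀ y, (discrepancyKernel t x y).re ≤ C) {r : ℤ} (hr : ¬ (n : ℤ) ∣ r)
    (z : UnitAddCircle) :
    (∑ j, combKernel t n 0 (x j - z)).re + ‖∑ j, combKernel t n r (x j - z)‖ ≤ n * (1 + C) := by
  have hn0 : (0 : ℝ) < n := by exact_mod_cast hn
  set B := ∑ j, combKernel t n r (x j - z) with hB
  set D := ∑ j, combKernel t n 0 (x j - z) with hD
  set q : ℕ → UnitAddCircle := fun l => (((l : ℝ) / (n : ℝ) : ℝ) : UnitAddCircle) with hq
  set S : ℕ → ℂ := fun l => ∑ j, heatKernel t (x j - z + q l) with hS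
  -- The phase u aligns the class-r contribution, so that the weighted average picks up its full
  -- modulus.
  obtain ⟨u, hu, huB⟩ : ∃ u : ℂ, ‖u‖ = 1 ∧ u * B = ‖B‖ := by
    by_cases h : B = 0
    · exact ⟨1, by simp, by simp [h]⟩
    · have hBn : (‖B‖ : ℂ) ≠ 0 := by exact_mod_cast norm_ne_zero_iff.2 h
      refine ⟨(starRingEnd ℂ) B / ‖B‖, ?_, ?_⟩
      · rw [norm_div, RCLike.norm_conj, Complex.norm_real, norm_norm,
          div_self (norm_ne_zero_iff.2 h)]
      · rw [div_mul_eq_mul_div, Complex.conj_mul', sq, mul_div_assoc, div_self hBn, mul_one]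
  have hSim : ∀ l, (S l).im = 0 := by
    intro l
    rw [← Complex.conj_eq_iff_im, hS]
    simp [conj_heatKernel]
  have hSre : ∀ l, (S l).re ≤ n * (1 + C) := by
    intro l
    have h := hx (z - q l)
    have he : discrepancyKernel t x (z - q l) = (1 / (n : ℂ)) * S l - 1 := by
      simp only [discrepancyKernel, hS]
      congr 3
      funext j
      congr 1
      abel
    rw [he, show (1 / (n : ℂ)) = ((1 / (n : ℝ) : ℝ) : ℂ) by push_cast; rfl, Complex.sub_re,
      Complex.re_ofReal_mul, Complex.one_re, one_div] at h
    rw [← inv_mul_le_iff₀ hn0]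
    linarith
  have hw : ∀ l, 0 ≤ 1 + (u * fourier (-r) (q l)).re := by
    intro l
    have h := Complex.abs_re_le_norm (u * fourier (-r) (q l))
    rw [norm_mul, hu, norm_fourier_apply, one_mul] at h
    linarith [(abs_le.1 h).1]
  have hcomb : ∀ s : ℤ, ∑ l ∈ Finset.range n, (fourier (-s) (q l) : ℂ) * S l =
      n * ∑ j, combKernel t n s (x j - z) := by
    intro s
    simp only [hS, Finset.mul_sum]
    rw [Finset.sum_comm]
    exact Finset.sum_congr rfl fun j _ => sum_fourier_mul_heatKernel ht hn s _
  have hleft : ∑ l ∈ Finset.range n, (1 + (u * fourier (-r) (q l)).re) * (S l).re =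
      n * (D.re + ‖B‖) := by
    have h1 : ∑ l ∈ Finset.range n, ((1 + (u * fourier (-r) (q l)).re) * (S l).re) =
        (∑ l ∈ Finset.range n, (S l + u * ((fourier (-r) (q l) : ℂ) * S l))).re := by
      rw [Complex.re_sum]
      refine Finset.sum_congr rfl fun l _ => ?_
      rw [Complex.add_re, ← mul_assoc, Complex.mul_re (u * _), hSim]
      ring
    have h0 := hcomb 0
    simp only [neg_zero, fourier_zero, one_mul] at h0
    rw [h1, Finset.sum_add_distrib, ← Finset.mul_sum, hcomb r, h0, ← hB, ← hD, mul_left_comm, huB,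
      ← mul_add, ← Complex.ofReal_natCast, Complex.re_ofReal_mul, Complex.add_re,
      Complex.ofReal_re]
  have hright : ∑ l ∈ Finset.range n, (1 + (u * fourier (-r) (q l)).re) = n := by
    rw [Finset.sum_add_distrib, ← Complex.re_sum, ← Finset.mul_sum, sum_fourier_div hn,
      if_neg (by rwa [dvd_neg])]
    simp
  have hle := Finset.sum_le_sum fun l (_ : l ∈ Finset.range n) =>
    mul_le_mul_of_nonneg_left (hSre l) (hw l)
  rw [hleft, ← Finset.sum_mul, hright] at hle
  exact le_of_mul_le_mul_left hle hn0

theorem norm_zpow_sub_one_le {u : ℂ} (hu : ‖u‖ = 1) (m : ℤ) :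
    ‖u ^ m - 1‖ ≤ |(m : ℝ)| * ‖u - 1‖ := by
  have hnat : ∀ k : ℕ, ‖u ^ k - 1‖ ≤ k * ‖u - 1‖ := by
    intro k
    induction k with
    | zero => simp
    | succ k ih =>
      have : u ^ (k + 1) - 1 = u * (u ^ k - 1) + (u - 1) := by ring
      rw [this]
      refine (norm_add_le _ _).trans ?_
      rw [norm_mul, hu, one_mul]
      push_cast
      linarith
  have hu0 : u ≠ 0 := by
    intro h
    simp [h] at hu
  rcases Int.eq_nat_or_neg m with ⟨k, rfl | rfl⟩
  · simpa using hnat k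
  · have h : u ^ (-(k : ℤ)) - 1 = -(u ^ (-(k : ℤ)) * (u ^ k - 1)) := by
      rw [zpow_neg, zpow_natCast]
      field_simp
      ring
    rw [h, norm_neg, norm_mul, norm_zpow, hu, one_zpow, one_mul]
    simpa using hnat k

theorem re_unit_eq {v : ℂ} (hv : ‖v‖ = 1) : v.re = 1 - ‖v - 1‖ ^ 2 / 2 := by
  have h1 : v.re ^ 2 + v.im ^ 2 = 1 := by
    have := Complex.sq_norm v
    rw [hv, Complex.normSq_apply] at this
    nlinarith
  rw [Complex.sq_norm, Complex.normSq_apply]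
  simp
  nlinarith

theorem summable_and_tsum_sq_mul_le (ht : 0 < t) (hn : 1 ≤ n) {r : ℤ} (hr : r ^ 2 + n ≤ (n : ℤ) ^ 2) :
    (Summable fun m : ℤ => (m : ℝ) ^ 2 * gaussWeight t (n * m)) ∧
      ∑' m : ℤ, (m : ℝ) ^ 2 * gaussWeight t (n * m) ≤
        1 * tailConst t * (gaussWeight t r * heatRatio t ^ n) := by
  refine summable_and_tsum_tail_le ht (fun m => sq_nonneg _) (fun m => by rw [one_mul])
    fun m => ?_
  rcases eq_or_ne m 0 with rfl | hm
  · left; simp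
  · right
    have h1 : 1 ≤ m ^ 2 := by
      have := sq_pos_of_ne_zero hm
      omega
    have h3 : 1 ≤ (n : ℤ) ^ 2 := by
      zify at hn
      nlinarith
    nlinarith

/-- The loss is quadratic because Re v = 1 - |v - 1|²/2 on the unit circle, applied to v = e(ny)^m.
-/
theorem combMax_sub_le_re_combKernel (ht : 0 < t) (hn : 2 ≤ n) (y : UnitAddCircle) :
    combMax t n - (∑' m : ℤ, (m : ℝ) ^ 2 * gaussWeight t (n * m)) / 2 *
      ‖(fourier n y : ℂ) - 1‖ ^ 2 ≤ (combKernel t n 0 y).re := by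
  have hs := (summable_and_tsum_sq_mul_le ht (by omega : 1 ≤ n) (r := 0) (by zify at hn; nlinarith)).1
  have hs0 := summable_gaussWeight_comb ht (by omega : 1 ≤ n) 0
  simp only [zero_add] at hs0
  have hsK := summable_combKernel ht (by omega : 1 ≤ n) 0 y
  rw [combKernel, Complex.re_tsum hsK, combMax, ← tsum_div_const, ← tsum_mul_right,
    ← hs0.tsum_sub ((hs.div_const 2).mul_right _)]
  refine (hs0.sub ((hs.div_const 2).mul_right _)).tsum_le_tsum (fun m => ?_)
    ((Complex.reCLM.summable hsK))
  have hu : ‖(fourier n y : ℂ) ^ m‖ = 1 := by rw [norm_zpow, norm_fourier_apply, one_zpow]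
  rw [zero_add, fourier_mul_apply, Complex.re_ofReal_mul, re_unit_eq hu]
  have h := norm_zpow_sub_one_le (norm_fourier_apply (n : ℤ) y) m
  have h2 := pow_le_pow_left₀ (norm_nonneg _) h 2
  rw [mul_pow, sq_abs] at h2
  have := mul_le_mul_of_nonneg_left h2 (gaussWeight_pos t (n * m)).le
  linarith

end Comb

/-! ### First-order gain of the comb at r, and its degenerate form when n = 2r. -/

section Optimality

variable {n : ℕ} {t : ℝ}

/-- The term m = 0 has modulus e^{-4π²r²t} ε. Near the coset, e((r + nm)y_j) differs from e(r y_j)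
by at most 2nε|m|, so the remaining exponential sums are also O(ε) and the tail is small relative to
the main term. -/
theorem le_norm_sum_combKernel (ht : 0 < t) {r : ℕ} (hr : 1 ≤ r) (hrn : 2 * r < n)
    (y : Fin n → UnitAddCircle) {ε : ℝ} (hε : ‖∑ j, (fourier r (y j) : ℂ)‖ = ε)
    (hy : ∀ j, ‖(fourier n (y j) : ℂ) - 1‖ ≤ 2 * n * ε) :
    gaussWeight t r * ε - 3 * n ^ 2 * ε * (tailConst t * (gaussWeight t r * heatRatio t ^ n)) ≤
      ‖∑ j, combKernel t n r (y j)‖ := by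
  have hn : 1 ≤ n := by omega
  have hε0 : 0 ≤ ε := hε ▸ norm_nonneg _
  set Q : ℤ → ℂ := fun m => ∑ j, (fourier (r + n * m) (y j) : ℂ) with hQ
  have hQm : ∀ m : ℤ, m ≠ 0 → ‖Q m‖ ≤ 3 * n ^ 2 * ε * |(m : ℝ)| := by
    intro m hm
    have h : Q m = ∑ j, (fourier r (y j) : ℂ) +
        ∑ j, (fourier r (y j) : ℂ) * ((fourier n (y j) : ℂ) ^ m - 1) := by
      rw [hQ, ← Finset.sum_add_distrib]
      refine Finset.sum_congr rfl fun j _ => ?_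
      rw [fourier_add, fourier_mul_apply]
      ring
    have h2 : ‖∑ j, (fourier r (y j) : ℂ) * ((fourier n (y j) : ℂ) ^ m - 1)‖ ≤
        ∑ j : Fin n, |(m : ℝ)| * (2 * n * ε) := by
      refine (norm_sum_le _ _).trans (Finset.sum_le_sum fun j _ => ?_)
      rw [norm_mul, norm_fourier_apply, one_mul]
      exact (norm_zpow_sub_one_le (norm_fourier_apply _ _) m).trans
        (mul_le_mul_of_nonneg_left (hy j) (abs_nonneg _))
    simp only [Finset.sum_const, Finset.card_univ, Fintype.card_fin, nsmul_eq_mul] at h2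
    have h1m : (1 : ℝ) ≤ |(m : ℝ)| := by exact_mod_cast Int.one_le_abs hm
    have h1n : (1 : ℝ) ≤ (n : ℝ) ^ 2 := one_le_pow₀ (by exact_mod_cast hn)
    have h3 : ε * 1 ≤ ε * ((n : ℝ) ^ 2 * |(m : ℝ)|) :=
      mul_le_mul_of_nonneg_left (one_le_mul_of_one_le_of_one_le h1n h1m) hε0
    rw [h]
    refine (norm_add_le _ _).trans ?_
    rw [hε]
    nlinarith
  have hsum : ∑ j, combKernel t n r (y j) =
      ∑' m : ℤ, (gaussWeight t (r + n * m) : ℂ) * Q m := by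
    simp only [combKernel]
    rw [← Summable.tsum_finsetSum fun j _ => summable_combKernel ht hn r (y j)]
    simp only [hQ, Finset.mul_sum]
  have hsumm : Summable fun m : ℤ => (gaussWeight t (r + n * m) : ℂ) * Q m := by
    simp only [hQ, Finset.mul_sum]
    exact summable_sum fun j _ => summable_combKernel ht hn r (y j)
  obtain ⟨htail, htail_le⟩ := summable_and_tsum_tail_le ht (B := 1) (b := fun m => |(m : ℝ)|)
    (g := fun m => r + n * m) (r := r) (n := n) (fun m => abs_nonneg _)
    (fun m => by
      rw [one_mul, ← sq_abs]
      rcases eq_or_ne m 0 with rfl | hm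
      · simp
      · exact le_self_pow₀ (by exact_mod_cast Int.one_le_abs hm) two_ne_zero)
    (fun m => by
      rcases eq_or_ne m 0 with rfl | hm
      · left; simp
      · right
        -- The inequality is sharp: for m = -1 and n = 2r + 1 it is an equality, and for n = 2r it
        -- fails.
        have hrn' : 2 * (r : ℤ) + 1 ≤ n := by exact_mod_cast hrn
        have hr' : (1 : ℤ) ≤ r := by exact_mod_cast hr
        rcases lt_or_gt_of_ne hm with h | h
        · obtain ⟨a, rfl⟩ : ∃ a : ℕ, m = -(a : ℤ) - 1 := ⟨(-m - 1).toNat, by omega⟩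
          obtain ⟨d, hd⟩ : ∃ d : ℕ, (n : ℤ) = 2 * r + 1 + d := ⟨n - 2 * r - 1, by omega⟩
          rw [hd]
          have ha : (0 : ℤ) ≤ a := by positivity
          have hd0 : (0 : ℤ) ≤ d := by positivity
          obtain ⟨c, hc⟩ : ∃ c : ℕ, (r : ℤ) = 1 + c := ⟨r - 1, by omega⟩
          rw [hc]
          have hc0 : (0 : ℤ) ≤ c := by positivity
          ring_nf
          nlinarith [mul_nonneg ha hd0, mul_nonneg ha hc0, mul_nonneg hc0 hd0,
            mul_nonneg (mul_nonneg ha ha) hd0, mul_nonneg (mul_nonneg ha ha) hc0,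
            mul_nonneg (mul_nonneg ha hc0) hd0, mul_nonneg (mul_nonneg ha hd0) hd0,
            mul_nonneg (mul_nonneg ha hc0) hc0,
            mul_nonneg (mul_nonneg ha ha) (mul_nonneg hc0 hd0),
            mul_nonneg (mul_nonneg ha ha) (mul_nonneg hc0 hc0),
            mul_nonneg (mul_nonneg ha ha) (mul_nonneg hd0 hd0)]
        · obtain ⟨a, rfl⟩ : ∃ a : ℕ, m = (a : ℤ) + 1 := ⟨(m - 1).toNat, by omega⟩
          have ha : (0 : ℤ) ≤ a := by positivity
          have h1 : (1 : ℤ) ≤ (n : ℤ) * n := by nlinarith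
          have h2 : (n : ℤ) ≤ n * r := by nlinarith
          have h3 : 0 ≤ (n : ℤ) * r * a := by positivity
          have h4 : 0 ≤ ((n : ℤ) * n - 1) * (a + 1) ^ 2 :=
            mul_nonneg (by linarith) (sq_nonneg _)
          nlinarith)
  have hrest : ‖∑' m : ℤ, (if m = 0 then 0 else (gaussWeight t (r + n * m) : ℂ) * Q m)‖ ≤
      3 * n ^ 2 * ε * (tailConst t * (gaussWeight t r * heatRatio t ^ n)) := by
    have hs := (htail.mul_left (3 * n ^ 2 * ε))
    refine (tsum_of_norm_bounded hs.hasSum fun m => ?_).trans ?_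
    · split_ifs with hm
      · simp [hm]
      · rw [norm_mul, Complex.norm_real, Real.norm_of_nonneg (gaussWeight_pos t _).le]
        have := mul_le_mul_of_nonneg_left (hQm m hm) (gaussWeight_pos t (r + n * m)).le
        linarith
    · rw [tsum_mul_left]
      refine mul_le_mul_of_nonneg_left ?_ (by positivity)
      simpa using htail_le
  rw [hsum, hsumm.tsum_eq_add_tsum_ite 0]
  have h0 : ‖(gaussWeight t (r + n * 0) : ℂ) * Q 0‖ = gaussWeight t r * ε := by
    rw [norm_mul, Complex.norm_real, Real.norm_of_nonneg (gaussWeight_pos t _).le]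
    simp only [hQ, mul_zero, add_zero, hε]
  have := norm_sub_le_norm_add ((gaussWeight t (r + n * 0) : ℂ) * Q 0)
    (∑' m : ℤ, (if m = 0 then 0 else (gaussWeight t (r + n * m) : ℂ) * Q m))
  rw [h0] at this
  linarith

/-- The difference equals v^{-(2m+1)} (v^{2m} - 1)(v^{2m+2} - 1)/2, which has two factors vanishing
at v² = 1; hence the bound is quadratic. -/
theorem abs_re_zpow_sub_re_le {v : ℂ} (hv : ‖v‖ = 1) (m : ℤ) :
    |(v ^ (2 * m + 1)).re - v.re| ≤ |(m : ℝ) * (m + 1)| / 2 * ‖v ^ 2 - 1‖ ^ 2 := by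
  have hv0 : v ≠ 0 := by
    intro h
    simp [h] at hv
  have hconj : ∀ k : ℤ, (starRingEnd ℂ) (v ^ k) = v ^ (-k) := by
    intro k
    rw [map_zpow₀, zpow_neg, ← inv_zpow, Complex.inv_def, Complex.normSq_eq_norm_sq, hv]
    simp
  have hre : ∀ k : ℤ, ((v ^ k).re : ℂ) = (v ^ k + v ^ (-k)) / 2 := by
    intro k
    rw [← hconj, Complex.add_conj]
    push_cast
    ring
  have hv2 : ‖v ^ 2‖ = 1 := by rw [norm_pow, hv, one_pow]
  have key : (((v ^ (2 * m + 1)).re - v.re : ℝ) : ℂ) =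
      v ^ (-(2 * m + 1)) * ((v ^ 2) ^ m - 1) * ((v ^ 2) ^ (m + 1) - 1) / 2 := by
    have h1 := hre 1
    rw [zpow_one] at h1
    rw [Complex.ofReal_sub, hre, h1]
    have h2 : (v ^ 2) ^ m = v ^ m * v ^ m := by rw [sq, mul_zpow]
    simp only [zpow_add₀ hv0, zpow_neg, zpow_mul, zpow_one, zpow_add₀ (pow_ne_zero 2 hv0), h2,
      show v ^ (2 : ℤ) = v ^ 2 from by norm_cast]
    have hm : v ^ m ≠ 0 := zpow_ne_zero _ hv0
    field_simp
    ring
  have h := congrArg norm key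
  rw [Complex.norm_real, Real.norm_eq_abs] at h
  rw [h, norm_div, norm_mul, norm_mul, norm_zpow, hv, one_zpow, one_mul, abs_mul]
  have ha := norm_zpow_sub_one_le hv2 m
  have hb := norm_zpow_sub_one_le hv2 (m + 1)
  push_cast at hb
  have := mul_le_mul ha hb (norm_nonneg _) (by positivity)
  rw [RCLike.norm_ofNat]
  nlinarith

/-- All frequencies are odd multiples of r, and near the coset each has almost the same real part as
r itself. The factor m(m + 1) removes m = 0 and m = -1, the frequencies ±r, so the error carries
only tail weight. -/
theorem abs_re_combKernel_sub_le (ht : 0 < t) {r : ℕ} (hr : 1 ≤ r) (hrn : n = 2 * r)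
    (y : UnitAddCircle) :
    |(combKernel t n r y).re - (∑' m : ℤ, gaussWeight t (r + n * m)) * (fourier r y : ℂ).re| ≤
      tailConst t * (gaussWeight t r * heatRatio t ^ n) * ‖(fourier n y : ℂ) - 1‖ ^ 2 := by
  have hn : 1 ≤ n := by omega
  set v : ℂ := fourier r y with hv
  have hv1 : ‖v‖ = 1 := norm_fourier_apply _ _
  have hterm : ∀ m : ℤ, (fourier (r + n * m) y : ℂ) = v ^ (2 * m + 1) := by
    intro m
    rw [hv, ← fourier_mul_apply]
    congr 2
    rw [hrn]
    push_cast
    ring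
  have hv2 : (fourier n y : ℂ) = v ^ 2 := by
    rw [hv, ← zpow_natCast, ← fourier_mul_apply]
    congr 2
    rw [hrn]
    push_cast
    ring
  obtain ⟨htail, htail_le⟩ := summable_and_tsum_tail_le ht (B := 2)
    (b := fun m => |(m : ℝ) * (m + 1)|)
    (g := fun m => r + n * m) (r := r) (n := n) (fun m => abs_nonneg _)
    (fun m => by
      have h1 : |m * (m + 1)| ≤ 2 * m ^ 2 := by
        rcases lt_trichotomy m 0 with h | rfl | h
        · rw [abs_le]; constructor <;> nlinarith
        · simp
        · rw [abs_le]; constructor <;> nlinarith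
      exact_mod_cast h1)
    (fun m => by
      have hn' : (n : ℤ) = 2 * r := by exact_mod_cast hrn
      have hr' : (1 : ℤ) ≤ r := by exact_mod_cast hr
      have hrr : (r : ℤ) ≤ r ^ 2 := by nlinarith
      have hsq : ((r : ℤ) + n * m) ^ 2 = r ^ 2 + 4 * r ^ 2 * (m * (m + 1)) := by
        rw [hn']; ring
      by_cases h0 : m = 0
      · left; simp [h0]
      by_cases h1 : m = -1
      · left; simp [h1]
      right
      have h2 : 2 ≤ m * (m + 1) ∧ m ^ 2 ≤ 2 * (m * (m + 1)) := by
        rcases lt_or_gt_of_ne h0 with h | h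
        · have : m ≤ -2 := by omega
          constructor <;> nlinarith
        · constructor <;> nlinarith
      simp only [hsq]
      nlinarith [mul_le_mul hrr h2.1 (by norm_num) (by positivity)])
  have hsK := summable_combKernel ht hn r y
  have hs0 := summable_gaussWeight_comb ht hn r
  have hsR : Summable fun m : ℤ =>
      ((gaussWeight t (r + n * m) : ℂ) * fourier (r + n * m) y).re := Complex.reCLM.summable hsK
  rw [combKernel, Complex.re_tsum hsK, ← tsum_mul_right,
    ← hsR.tsum_sub (hs0.mul_right _), ← Real.norm_eq_abs, hv2]
  refine (tsum_of_norm_bounded ((htail.div_const 2).mul_right (‖v ^ 2 - 1‖ ^ 2)).hasSum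
    fun m => ?_).trans ?_
  · rw [hterm, Complex.re_ofReal_mul, ← mul_sub, norm_mul,
      Real.norm_of_nonneg (gaussWeight_pos t _).le, Real.norm_eq_abs]
    have := mul_le_mul_of_nonneg_left (abs_re_zpow_sub_re_le hv1 m)
      (gaussWeight_pos t (r + n * m)).le
    linarith
  · rw [tsum_mul_right, tsum_div_const]
    refine mul_le_mul_of_nonneg_right ?_ (by positivity)
    linarith

end Optimality

/-! ### Rigidity: the power sums vanish and the points are equispaced. -/

section Minimizers

variable {n : ℕ} {t : ℝ}

theorem combMax_sub_one (ht : 0 < t) (hn : 1 ≤ n) :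
    combMax t n - 1 = ∑' m : ℤ, (if m = 0 then 0 else 1) * gaussWeight t (n * m) := by
  have h := summable_gaussWeight_comb ht hn 0
  simp only [zero_add] at h
  rw [combMax, h.tsum_eq_add_tsum_ite 0, mul_zero, gaussWeight_zero, add_sub_cancel_left]
  exact tsum_congr fun m => by split_ifs <;> simp

theorem combMax_sub_one_nonneg (ht : 0 < t) (hn : 1 ≤ n) : 0 ≤ combMax t n - 1 := by
  rw [combMax_sub_one ht hn]
  exact tsum_nonneg fun m => mul_nonneg (by split_ifs <;> norm_num) (gaussWeight_pos t _).le

theorem combMax_sub_one_le (ht : 0 < t) (hn : 1 ≤ n) {r : ℤ} (hr : r ^ 2 + n ≤ (n : ℤ) ^ 2) :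
    combMax t n - 1 ≤ tailConst t * (gaussWeight t r * heatRatio t ^ n) := by
  obtain ⟨hs, hle⟩ := summable_and_tsum_sq_mul_le ht hn hr
  rw [one_mul] at hle
  rw [combMax_sub_one ht hn]
  have hb : ∀ m : ℤ, (if m = 0 then (0 : ℝ) else 1) * gaussWeight t (n * m) ≤
      (m : ℝ) ^ 2 * gaussWeight t (n * m) := by
    intro m
    refine mul_le_mul_of_nonneg_right ?_ (gaussWeight_pos t _).le
    split_ifs with hm
    · exact sq_nonneg _
    · rw [← sq_abs]
      exact one_le_pow₀ (by exact_mod_cast Int.one_le_abs hm)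
  have hs' := Summable.of_nonneg_of_le (fun m : ℤ => mul_nonneg
    (by split_ifs <;> norm_num : (0 : ℝ) ≤ if m = 0 then 0 else 1) (gaussWeight_pos t _).le) hb hs
  exact (hs'.tsum_le_tsum hb hs).trans hle

theorem le_sum_re_combKernel (ht : 0 < t) (hn : 2 ≤ n) {r : ℤ} (hr : r ^ 2 + n ≤ (n : ℤ) ^ 2)
    (y : Fin n → UnitAddCircle) {δ : ℝ} (hy : ∀ j, ‖(fourier n (y j) : ℂ) - 1‖ ≤ δ) :
    n * combMax t n - n * δ ^ 2 / 2 * (tailConst t * (gaussWeight t r * heatRatio t ^ n)) ≤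
      (∑ j, combKernel t n 0 (y j)).re := by
  obtain ⟨-, hle⟩ := summable_and_tsum_sq_mul_le ht (by omega : 1 ≤ n) hr
  rw [one_mul] at hle
  have hterm : ∀ j, combMax t n - tailConst t * (gaussWeight t r * heatRatio t ^ n) / 2 * δ ^ 2 ≤
      (combKernel t n 0 (y j)).re := by
    intro j
    refine le_trans ?_ (combMax_sub_le_re_combKernel ht hn (y j))
    refine sub_le_sub_left (mul_le_mul (by linarith)
      (pow_le_pow_left₀ (norm_nonneg _) (hy j) 2) (by positivity) ?_) _
    have := tailConst_nonneg t
    have := (gaussWeight_pos t r).le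
    have := (heatRatio_pos t).le
    positivity
  have h := Finset.sum_le_sum fun j (_ : j ∈ Finset.univ) => hterm j
  rw [Finset.sum_const, Finset.card_univ, Fintype.card_fin, nsmul_eq_mul] at h
  rw [Complex.re_sum]
  linarith

theorem sq_add_le_sq {r : ℕ} (hn : 2 ≤ n) (hrn : 2 * r ≤ n) :
    ((r : ℤ)) ^ 2 + n ≤ (n : ℤ) ^ 2 := by
  zify at hn hrn
  nlinarith

variable {x : Fin n → UnitAddCircle}

theorem norm_sum_fourier_sub (k : ℤ) (z : UnitAddCircle) :
    ‖∑ j, (fourier k (x j - z) : ℂ)‖ = ‖∑ j, (fourier k (x j) : ℂ)‖ := by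
  have h : ∀ j, (fourier k (x j - z) : ℂ) = fourier k (x j) * fourier k (-z) := by
    intro j
    rw [sub_eq_add_neg, fourier_add_apply]
  simp only [h, ← Finset.sum_mul, norm_mul, norm_fourier_apply, mul_one]

theorem sum_fourier_eq_zero_of_lt (ht : 0 < t)
    (hsmall : 100 * n ^ 3 * (tailConst t * heatRatio t ^ n) < 1)
    (hx : ∀ y, (discrepancyKernel t x y).re ≤ combMax t n - 1) {r : ℕ} (hr : 1 ≤ r)
    (hrn : 2 * r < n) (z : UnitAddCircle) {ε : ℝ} (hε : ‖∑ j, (fourier r (x j) : ℂ)‖ = ε)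
    (hε1 : ε ≤ 1) (hz : ∀ j, ‖(fourier n (x j - z) : ℂ) - 1‖ ≤ 2 * n * ε) : ε = 0 := by
  have hn : 2 ≤ n := by omega
  have hε0 : 0 ≤ ε := hε ▸ norm_nonneg _
  have h1 := re_combKernel_add_norm_le ht (by omega) x hx (r := r)
    (fun h => by have := Int.le_of_dvd (by omega) h; omega) z
  have h2 := le_sum_re_combKernel ht hn (sq_add_le_sq hn hrn.le) _ hz
  have h3 := le_norm_sum_combKernel ht hr hrn (fun j => x j - z)
    ((norm_sum_fourier_sub _ z).trans hε) hz
  by_contra hne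
  have hpos : 0 < ε := lt_of_le_of_ne hε0 (Ne.symm hne)
  have hg := gaussWeight_pos t r
  have hA : 0 ≤ tailConst t * heatRatio t ^ n :=
    mul_nonneg (tailConst_nonneg t) (pow_nonneg (heatRatio_pos t).le _)
  set A := tailConst t * heatRatio t ^ n with hAdef
  rw [show tailConst t * (gaussWeight t r * heatRatio t ^ n) = gaussWeight t r * A by ring]
    at h2 h3
  set g := gaussWeight t r
  have hn1 : (1 : ℝ) ≤ n := by exact_mod_cast (by omega : 1 ≤ n)
  have hsq : (n : ℝ) ^ 2 ≤ (n : ℝ) ^ 3 := pow_le_pow_right₀ hn1 (by norm_num)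
  -- Gain against losses: the left side is linear in ε, while every term on the right carries the
  -- small factor A.
  have h4 : g * ε ≤ 3 * n ^ 2 * ε * (g * A) + n * (2 * n * ε) ^ 2 / 2 * (g * A) := by linarith
  have h5 : (n : ℝ) ^ 2 * (ε * (g * A)) ≤ n ^ 3 * (ε * (g * A)) :=
    mul_le_mul_of_nonneg_right hsq (by positivity)
  have h6 : (n : ℝ) ^ 3 * (ε * (g * A)) * ε ≤ n ^ 3 * (ε * (g * A)) * 1 :=
    mul_le_mul_of_nonneg_left hε1 (by positivity)
  have h7 : g * ε * (100 * n ^ 3 * A) < g * ε * 1 :=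
    mul_lt_mul_of_pos_left hsmall (mul_pos hg hpos)
  have h8 : 0 ≤ (n : ℝ) ^ 3 * (ε * (g * A)) := by positivity
  nlinarith

/-- The squared real parts after rotation by α and by -α add up to 2(a² cos² α + b² sin² α) for P =
a + ib, which is at least 2|P|² sin² α. One of the two rotations therefore works. -/
theorem exists_norm_mul_sin_le (P : ℂ) {α : ℝ}
    (h1 : Real.sin α ^ 2 ≤ Real.cos α ^ 2) :
    ∃ β : ℝ, |β| = |α| ∧ ‖P‖ * Real.sin α ≤ |(P * Complex.exp (β * Complex.I)).re| := by
  have hre : ∀ β : ℝ, (P * Complex.exp (β * Complex.I)).re =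
      P.re * Real.cos β - P.im * Real.sin β := by
    intro β
    rw [Complex.mul_re, Complex.exp_ofReal_mul_I_re, Complex.exp_ofReal_mul_I_im]
  by_contra! hcon
  have ha := hcon α rfl
  have hb := hcon (-α) (abs_neg α)
  rw [hre] at ha hb
  rw [Real.cos_neg, Real.sin_neg] at hb
  have hP := norm_nonneg P
  have ha2 := sq_lt_sq' (by linarith [abs_nonneg (P.re * Real.cos α - P.im * Real.sin α)]) ha
  have hb2 := sq_lt_sq' (by linarith [abs_nonneg (P.re * Real.cos α - P.im * -Real.sin α)]) hb
  rw [sq_abs, mul_pow, Complex.sq_norm, Complex.normSq_apply] at ha2 hb2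
  nlinarith [mul_le_mul_of_nonneg_left h1 (sq_nonneg P.re)]

theorem sum_fourier_eq_zero_of_eq (ht : 0 < t)
    (hsmall : 100 * n ^ 3 * (tailConst t * heatRatio t ^ n) < 1)
    (hx : ∀ y, (discrepancyKernel t x y).re ≤ combMax t n - 1) {r : ℕ} (hr : 1 ≤ r)
    (hrn : n = 2 * r) (z : UnitAddCircle) {ε : ℝ} (hε : ‖∑ j, (fourier r (x j) : ℂ)‖ = ε)
    (hε1 : ε ≤ 1) (hz : ∀ j, ‖(fourier n (x j - z) : ℂ) - 1‖ ≤ 2 * n * ε) : ε = 0 := by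
  have hn : 2 ≤ n := by omega
  have hε0 : 0 ≤ ε := hε ▸ norm_nonneg _
  have hn1 : (1 : ℝ) ≤ n := by exact_mod_cast (by omega : 1 ≤ n)
  by_contra hne
  have hpos : 0 < ε := lt_of_le_of_ne hε0 (Ne.symm hne)
  have hsin : ε / 4 ≤ Real.sin (ε / 2) := by
    have := Real.sin_gt_sub_cube (x := ε / 2) (by positivity)
    have h3 : ε ^ 3 ≤ ε := pow_le_of_le_one hε0 hε1 (by norm_num)
    nlinarith
  have hsin' : Real.sin (ε / 2) ≤ 1 / 2 := (Real.sin_le (by positivity)).trans (by linarith)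
  -- An angle proportional to ε yields a real part of at least ε²/4, while the n-th powers move by
  -- only 2|β| = ε.
  obtain ⟨β, hβ, hP⟩ := exists_norm_mul_sin_le (∑ j, (fourier r (x j - z) : ℂ)) (α := ε / 2)
    (by nlinarith [Real.sin_sq_add_cos_sq (ε / 2)])
  rw [abs_of_nonneg (by positivity : 0 ≤ ε / 2)] at hβ
  rw [norm_sum_fourier_sub, hε] at hP
  set s : UnitAddCircle := ((β / (2 * Real.pi * r) : ℝ) : UnitAddCircle) with hs
  have hr0 : (r : ℂ) ≠ 0 := by exact_mod_cast (by omega : r ≠ 0)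
  have hpi : (Real.pi : ℂ) ≠ 0 := by exact_mod_cast Real.pi_ne_zero
  have hsr : (fourier r s : ℂ) = Complex.exp (β * Complex.I) := by
    rw [hs, fourier_coe_apply]
    congr 1
    push_cast
    field_simp
  have hsn : (fourier n s : ℂ) = Complex.exp (Complex.I * (2 * β : ℝ)) := by
    rw [hs, fourier_coe_apply, hrn]
    congr 1
    push_cast
    field_simp
  have hsn1 : ‖(fourier n s : ℂ) - 1‖ ≤ ε := by
    rw [hsn]
    refine (Real.norm_exp_I_mul_ofReal_sub_one_le).trans (le_of_eq ?_)
    rw [Real.norm_eq_abs, abs_mul, hβ, abs_two]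
    ring
  have hsplit : ∀ j, x j - (z - s) = (x j - z) + s := fun j => by abel
  have hz' : ∀ j, ‖(fourier n (x j - (z - s)) : ℂ) - 1‖ ≤ 3 * n * ε := by
    intro j
    rw [hsplit, fourier_add_apply, show (fourier n (x j - z) : ℂ) * fourier n s - 1 =
      fourier n (x j - z) * (fourier n s - 1) + (fourier n (x j - z) - 1) by ring]
    refine (norm_add_le _ _).trans ?_
    rw [norm_mul, norm_fourier_apply, one_mul]
    nlinarith [hz j]
  have h1 := re_combKernel_add_norm_le ht (by omega) x hx (r := r)
    (fun h => by have := Int.le_of_dvd (by omega) h; omega) (z - s)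
  have h2 := le_sum_re_combKernel ht hn (sq_add_le_sq hn hrn.ge) _ hz'
  have hg := gaussWeight_pos t r
  have hA : 0 ≤ tailConst t * heatRatio t ^ n :=
    mul_nonneg (tailConst_nonneg t) (pow_nonneg (heatRatio_pos t).le _)
  have h3 : ∀ j, |(combKernel t n r (x j - (z - s))).re -
      (∑' m : ℤ, gaussWeight t (r + n * m)) * (fourier r (x j - (z - s)) : ℂ).re| ≤
      tailConst t * (gaussWeight t r * heatRatio t ^ n) * (3 * n * ε) ^ 2 := by
    intro j
    refine (abs_re_combKernel_sub_le ht hr hrn _).trans (mul_le_mul_of_nonneg_left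
      (pow_le_pow_left₀ (norm_nonneg _) (hz' j) 2) ?_)
    rw [mul_left_comm]
    exact mul_nonneg hg.le hA
  have hT : gaussWeight t r ≤ ∑' m : ℤ, gaussWeight t (r + n * m) := by
    have := (summable_gaussWeight_comb ht (by omega : 1 ≤ n) r).le_tsum 0
      fun m _ => (gaussWeight_pos t _).le
    simpa using this
  set T := ∑' m : ℤ, gaussWeight t (r + n * m)
  set A := tailConst t * heatRatio t ^ n with hAdef
  rw [show tailConst t * (gaussWeight t r * heatRatio t ^ n) = gaussWeight t r * A by ring]
    at h2 h3
  set g := gaussWeight t r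
  have h4 : |(∑ j, combKernel t n r (x j - (z - s))).re -
      T * ((∑ j, (fourier r (x j - z) : ℂ)) * Complex.exp (β * Complex.I)).re| ≤
      n * (g * A * (3 * n * ε) ^ 2) := by
    rw [← hsr, Finset.sum_mul, Complex.re_sum, Complex.re_sum, Finset.mul_sum,
      ← Finset.sum_sub_distrib]
    refine (Finset.abs_sum_le_sum_abs _ _).trans ?_
    have := Finset.sum_le_sum fun j (_ : j ∈ Finset.univ) => h3 j
    rw [Finset.sum_const, Finset.card_univ, Fintype.card_fin, nsmul_eq_mul] at this
    simpa only [hsplit, fourier_add_apply] using this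
  set Q := ((∑ j, (fourier r (x j - z) : ℂ)) * Complex.exp (β * Complex.I)).re
  have h5 : T * |Q| ≤ ‖∑ j, combKernel t n r (x j - (z - s))‖ +
      n * (g * A * (3 * n * ε) ^ 2) := by
    have ha := Complex.abs_re_le_norm (∑ j, combKernel t n r (x j - (z - s)))
    have hb := abs_sub_abs_le_abs_sub (T * Q) (∑ j, combKernel t n r (x j - (z - s))).re
    rw [abs_sub_comm, abs_mul, abs_of_pos (hg.trans_le hT)] at hb
    linarith
  have h6 : g * (ε * (ε / 4)) ≤ T * |Q| :=
    mul_le_mul hT ((mul_le_mul_of_nonneg_left hsin hε0).trans hP) (by positivity)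
      (hg.le.trans hT)
  have h7 : g * ε ^ 2 * (100 * n ^ 3 * A) < g * ε ^ 2 * 1 :=
    mul_lt_mul_of_pos_left hsmall (by positivity)
  have h8 : g * (ε * (ε / 4)) ≤ n * (3 * n * ε) ^ 2 / 2 * (g * A) +
    n * (g * A * (3 * n * ε) ^ 2) := by linarith
  nlinarith

/-- Points whose discrepancy nowhere exceeds that of equispaced points are equispaced. -/
theorem equispaced_of_worstCaseError_le (ht : 0 < t) (hn : 2 ≤ n)
    (hsmall : 100 * n ^ 3 * (tailConst t * heatRatio t ^ n) < 1)
    (hW : worstCaseError t x ≤ ENNReal.ofReal (combMax t n - 1)) : Equispaced x := by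
  have hC0 := combMax_sub_one_nonneg ht (by omega : 1 ≤ n)
  have hx := re_discrepancyKernel_le x ht hC0 hW
  have hn0 : (0 : ℝ) < n := by exact_mod_cast (by omega : 0 < n)
  have hn1 : (1 : ℝ) ≤ n := by exact_mod_cast (by omega : 1 ≤ n)
  have hA : 0 ≤ tailConst t * heatRatio t ^ n :=
    mul_nonneg (tailConst_nonneg t) (pow_nonneg (heatRatio_pos t).le _)
  -- The bound on `combMax t n - 1` contains the same weight `gaussWeight t k` as the character
  -- test, so that weight cancels.
  have hone : ∀ k : ℕ, 1 ≤ k → 2 * k ≤ n → ‖∑ j, (fourier k (x j) : ℂ)‖ ≤ 1 := by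
    intro k hk hkn
    have h := gaussWeight_mul_norm_sum_fourier_le x hC0 hW (k := k) (by omega)
    have h2 := mul_le_mul_of_nonneg_left
      (combMax_sub_one_le ht (by omega : 1 ≤ n) (sq_add_le_sq hn hkn)) hn0.le
    have h3 : (n : ℝ) * (tailConst t * heatRatio t ^ n) ≤
        100 * n ^ 3 * (tailConst t * heatRatio t ^ n) := by
      refine mul_le_mul_of_nonneg_right ?_ hA
      have := le_self_pow₀ hn1 (three_ne_zero)
      nlinarith
    have hg := gaussWeight_pos t k
    refine le_of_mul_le_mul_left ((h.trans h2).trans ?_) hg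
    have := mul_le_mul_of_nonneg_left (h3.trans hsmall.le) hg.le
    linarith
  -- The maximal power sum gives one ε that both bounds all the others, as Newton's identities
  -- require, and is attained at a frequency where the gain can be measured.
  obtain ⟨r, hr, hmax⟩ := (Finset.Icc 1 (n / 2)).exists_max_image
    (fun k : ℕ => ‖∑ j, (fourier k (x j) : ℂ)‖) ⟨1, Finset.mem_Icc.2 (by omega)⟩
  rw [Finset.mem_Icc] at hr
  obtain ⟨ε, hε⟩ : ∃ ε, ‖∑ j, (fourier r (x j) : ℂ)‖ = ε := ⟨_, rfl⟩
  have hε0 : 0 ≤ ε := hε ▸ norm_nonneg _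
  have hε1 : ε ≤ 1 := hε ▸ hone r hr.1 (by omega)
  set w : Fin n → ℂ := fun j => fourier 1 (x j) with hw
  have hwpow : ∀ j (k : ℕ), w j ^ k = fourier k (x j) := by
    intro j k
    have := fourier_mul_apply 1 k (x j)
    rw [one_mul, zpow_natCast] at this
    exact this.symm
  have hwn : ∀ j, ‖w j‖ = 1 := fun j => norm_fourier_apply _ _
  have hp : ∀ k, 1 ≤ k → 2 * k ≤ n → ‖∑ j, w j ^ k‖ ≤ ε := by
    intro k h1 h2
    simp only [hwpow]
    exact hε ▸ hmax k (Finset.mem_Icc.2 (by omega))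
  set i₀ : Fin n := ⟨0, by omega⟩
  have hz : ∀ j, ‖(fourier n (x j - x i₀) : ℂ) - 1‖ ≤ 2 * n * ε := by
    intro j
    refine le_trans (le_of_eq ?_) (norm_pow_sub_pow_le (by omega) w hwn hε0 hε1 hp j i₀)
    have h := norm_mul ((fourier n (x j - x i₀) : ℂ) - 1) (fourier n (x i₀))
    rw [norm_fourier_apply, mul_one, sub_mul, fourier_sub_mul_apply, one_mul] at h
    rw [hwpow, hwpow, h]
  have hzero : ε = 0 := by
    rcases lt_or_eq_of_le (by omega : 2 * r ≤ n) with h | h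
    · exact sum_fourier_eq_zero_of_lt ht hsmall hx hr.1 h (x i₀) hε hε1 hz
    · exact sum_fourier_eq_zero_of_eq ht hsmall hx hr.1 h.symm (x i₀) hε hε1 hz
  subst hzero
  have hinj : Function.Injective x := by
    have := injective_of_powerSum_eq_zero (by omega) w hwn
      fun k h1 h2 => norm_le_zero_iff.1 (hp k h1 h2)
    exact fun a b hab => this (by simp only [hw, hab])
  have htors : ∀ j, ∃ l : Fin n, x j = x i₀ + (((l : ℝ) / (n : ℝ) : ℝ) : UnitAddCircle) := by
    intro j
    have h := hz j
    rw [mul_zero, norm_le_zero_iff, sub_eq_zero, fourier_apply, Circle.coe_eq_one,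
      ← toCircle_zero (T := 1)] at h
    have h' := injective_toCircle one_ne_zero h
    rw [natCast_zsmul, AddCircle.nsmul_eq_zero_iff (by omega)] at h'
    obtain ⟨m, hm, hmx⟩ := h'
    refine ⟨⟨m, hm⟩, ?_⟩
    rw [mul_one] at hmx
    simp only [hmx]
    abel
  choose l hl using htors
  have hlinj : Function.Injective l := by
    intro a b hab
    exact hinj (by rw [hl a, hl b, hab])
  set σ := Equiv.ofBijective l (Finite.injective_iff_bijective.1 hlinj)
  refine ⟨x i₀, σ.symm, fun k => ?_⟩
  rw [hl (σ.symm k)]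
  congr 4
  exact congrArg (fun i : Fin n => (i : ℕ)) (σ.apply_symm_apply k)

theorem discrepancyKernel_of_equispaced (ht : 0 < t) (hn : 1 ≤ n) (hx : Equispaced x) :
    ∃ z, ∀ y, discrepancyKernel t x y = combKernel t n 0 (z - y) - 1 := by
  obtain ⟨z, σ, hσ⟩ := hx
  refine ⟨z, fun y => ?_⟩
  have h := sum_fourier_mul_heatKernel ht hn 0 (z - y)
  simp only [neg_zero, fourier_zero, one_mul] at h
  have hn0 : (n : ℂ) ≠ 0 := by exact_mod_cast (by omega : n ≠ 0)
  rw [Finset.sum_range] at h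
  have h2 : ∑ j, heatKernel t (x j - y) = n * combKernel t n 0 (z - y) := by
    rw [← h, ← Equiv.sum_comp σ]
    refine Finset.sum_congr rfl fun k _ => ?_
    rw [hσ]
    congr 1
    abel
  rw [discrepancyKernel, h2, one_div, inv_mul_cancel_left₀ hn0]

theorem worstCaseError_of_equispaced (ht : 0 < t) (hn : 1 ≤ n) (hx : Equispaced x) :
    worstCaseError t x = ENNReal.ofReal (combMax t n - 1) := by
  obtain ⟨z, hz⟩ := discrepancyKernel_of_equispaced ht hn hx
  have hs := summable_gaussWeight_comb ht hn 0
  simp only [zero_add] at hs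
  have hle : worstCaseError t x ≤ ENNReal.ofReal (combMax t n - 1) := by
    refine worstCaseError_le x ht fun y => ?_
    have hsK := summable_combKernel ht hn 0 (z - y)
    rw [hz, combKernel, hsK.tsum_eq_add_tsum_ite 0, combMax, hs.tsum_eq_add_tsum_ite 0]
    simp only [mul_zero, zero_add, gaussWeight_zero, fourier_zero, Complex.ofReal_one, mul_one,
      add_sub_cancel_left]
    refine tsum_of_norm_bounded (Summable.hasSum ?_) fun m => ?_
    · refine Summable.of_nonneg_of_le (fun m => ?_) (fun m => ?_) hs
      · split_ifs
        exacts [le_rfl, (gaussWeight_pos t _).le]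
      · split_ifs
        exacts [(gaussWeight_pos t _).le, le_rfl]
    · split_ifs
      · simp
      · exact (norm_gaussWeight_mul_fourier t _ _).le
  refine le_antisymm hle ?_
  -- For the lower bound the error itself, now known to be finite, serves as C in the pointwise
  -- bound at the node z.
  have hfin : worstCaseError t x ≠ ⊤ := ne_top_of_le_ne_top ENNReal.ofReal_ne_top hle
  have h := re_discrepancyKernel_le x ht ENNReal.toReal_nonneg
    (ENNReal.ofReal_toReal hfin).ge z
  have hre : (discrepancyKernel t x z).re = combMax t n - 1 := by
    rw [hz, sub_self, combKernel]
    simp only [zero_add, fourier_eval_zero, mul_one]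
    rw [← Complex.ofReal_tsum, Complex.sub_re, Complex.ofReal_re, Complex.one_re, combMax]
  rw [hre] at h
  exact ENNReal.ofReal_le_of_le_toReal h

/-- The case n = 2r is the most demanding: its losses total (27/2) n³ A ε² against a gain of ε²/4,
with A = `tailConst t * heatRatio t ^ n`, so the constant 54 would do there. -/
theorem exists_forall_small (ht : 0 < t) :
    ∃ N : ℕ, ∀ n : ℕ, N ≤ n → 2 ≤ n ∧ 100 * n ^ 3 * (tailConst t * heatRatio t ^ n) < 1 := by
  have hρ : |heatRatio t| < 1 := by
    rw [abs_of_pos (heatRatio_pos t), heatRatio, Real.exp_lt_one_iff]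
    have : 0 < 4 * Real.pi ^ 2 * t := by positivity
    linarith
  have h := (tendsto_pow_const_mul_const_pow_of_abs_lt_one 3 hρ).const_mul (100 * tailConst t)
  rw [mul_zero] at h
  obtain ⟨N, hN⟩ := Filter.eventually_atTop.1
    ((h.eventually_lt_const zero_lt_one).and (Filter.eventually_ge_atTop 2))
  refine ⟨N, fun n hn => ⟨(hN n hn).2, lt_of_eq_of_lt ?_ (hN n hn).1⟩⟩
  ring

end Minimizers

end HeatSampling

end

theorem mainTheorem3 :
    ∀ t : ℝ, 0 < t → ∃ N : ℕ, ∀ n : ℕ, N ≤ n → ∀ x : Fin n → UnitAddCircle,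
      (∀ y : Fin n → UnitAddCircle,
        HeatSampling.worstCaseError t x ≤ HeatSampling.worstCaseError t y) ↔
      HeatSampling.Equispaced x := by
  intro t ht
  obtain ⟨N, hN⟩ := HeatSampling.exists_forall_small ht
  refine ⟨N, fun n hn x => ?_⟩
  obtain ⟨hn2, hsmall⟩ := hN n hn
  have hW : ∀ y : Fin n → UnitAddCircle, HeatSampling.Equispaced y →
      HeatSampling.worstCaseError t y = ENNReal.ofReal (HeatSampling.combMax t n - 1) :=
    fun y hy => HeatSampling.worstCaseError_of_equispaced ht (by omega) hy
  constructor
  · intro h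
    have he : HeatSampling.Equispaced
        fun k : Fin n => (((k : ℝ) / (n : ℝ) : ℝ) : UnitAddCircle) :=
      ⟨0, Equiv.refl _, fun k => (zero_add _).symm⟩
    exact HeatSampling.equispaced_of_worstCaseError_le ht hn2 hsmall ((h _).trans (hW _ he).le)
  · intro hx y
    -- A strictly better configuration would itself be equispaced by rigidity, hence would have the
    -- same error.
    by_contra! hlt
    have hy := HeatSampling.equispaced_of_worstCaseError_le ht hn2 hsmall
      (hlt.le.trans (hW x hx).le)
    rw [hW x hx, hW y hy] at hlt
    exact lt_irrefl _ hlt
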